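/- Let $R$ be a reflexive binary relation on a set $U$. Write $R(x)=\{y\in U\mid (x,y)\in R\}$, let $\breve R$ be the inverse of $R$, and for $X\subseteq U$ let $$X^{\blacktriangledown}=\{x\mid R(x)\subseteq X\},\qquad X^{\blacktriangle}=\{x\mid R(x)\cap X\neq\emptyset\},\qquad X^{\vartriangle}=\{x\mid \breve R(x)\cap X\neq\emptyset\}.$$ Let $\mathrm{RS}=\{(X^{\blacktriangledown},X^{\blacktriangle})\mid X\subseteq U\}$, ordered by coordinatewise inclusion, and let $\mathrm{DM(RS)}$ be its Dedekind--MacNeille completion. The core of a neighbourhood is $$\mathfrak{core}R(x)=\{w\in R(x)\mid \text{for all } y\in U,\ w\in R(y)\text{ implies }R(x)\subseteq R(y)\},$$ and $\mathfrak{core}\breve R(x)$ is defined in the same way with $\breve R$ in place of $R$. A Kleene algebra is a bounded distributive lattice with an operation $\sim$ satisfying ${\sim}{\sim}x=x$, the De Morgan laws, and $x\wedge{\sim}x\le y\vee{\sim}y$. A Nelson algebra is a Kleene algebra in which, for all $a,b$, there is a greatest element $x$ with $a\wedge x\le{\sim}a\vee b$, denoted $a\to b$, and $(a\wedge b)\to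 c=a\to(b\to c)$ holds for all $a,b,c$. Suppose that $\mathfrak{core}R(x)$ and $\mathfrak{core}\breve R(x)$ are nonempty for every $x\in U$. Then $\mathrm{DM(RS)}$ forms a Nelson algebra. More precisely, $\mathrm{DM(RS)}$ is order-isomorphic, by an isomorphism that fixes every rough set $(X^{\blacktriangledown},X^{\blacktriangle})$, to the set of all pairs $(A,B)$ such that $A=X^{\blacktriangledown}$ and $B=Y^{\blacktriangle}$ for some $X,Y\subseteq U$, $A^{\vartriangle\blacktriangle}\subseteq B$ and $A\cap\mathcal S=B\cap\mathcal S$, where $\mathcal S=\{x\in U\mid |R(x)|=1\}$, ordered by coordinatewise inclusion; and the lattice $\mathrm{DM(RS)}$ is a Nelson algebra with the negation ${\sim}(A,B)=(U\setminus B,\,U\setminus A)$ in this representation. Moreover, this covers some non-transitive relations: there exist a set $U$ and a reflexive, non-transitive relation $R$ on $U$ such that $\mathfrak{core}R(x)$ and $\mathfrak{core}\breve R(x)$ are nonempty for every $x\in U$. -/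

import Mathlib

namespace RoughSets

variable {U : Type*}

/-- The `R`-neighbourhood `R(x) = {y | (x, y) ∈ R}`. The inverse neighbourhood is
`nbhd (Function.swap R) x`. -/
def nbhd (R : U → U → Prop) (x : U) : Set U := {y | R x y}

/-- Lower approximation `X^▼ = {x | R(x) ⊆ X}`. -/
def lower (R : U → U → Prop) (X : Set U) : Set U := {x | nbhd R x ⊆ X}

/-- Upper approximation `X^▲ = {x | R(x) ∩ X ≠ ∅}`. The operation `X^△` is
`upper (Function.swap R) X`. -/
def upper (R : U → U → Prop) (X : Set U) : Set U := {x | (nbhd R x ∩ X).Nonempty}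

/-- The core of `R(x)`: all `w ∈ R(x)` such that, for every `y`, `w ∈ R(y)` implies
`R(x) ⊆ R(y)`. -/
def core (R : U → U → Prop) (x : U) : Set U :=
  {w | w ∈ nbhd R x ∧ ∀ y, w ∈ nbhd R y → nbhd R x ⊆ nbhd R y}

/-- The rough sets `(X^▼, X^▲)`, `X ⊆ U`. As a subtype of `Set U × Set U` this carries the
coordinatewise inclusion order. -/
def RS (R : U → U → Prop) : Set (Set U × Set U) :=
  {p | ∃ X : Set U, p = (lower R X, upper R X)}

/-- The Dedekind-MacNeille completion `DM(RS)` of the ordered set of rough sets. -/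
abbrev DM (R : U → U → Prop) := DedekindCut (RS R)

/-- The singletons: elements `x` such that `R(x) = {z}` for some `z`. -/
def singletons (R : U → U → Prop) : Set U := {x | ∃ z, nbhd R x = {z}}

/-- The concrete representation of `DM(RS)` by pairs `(A, B)` of a lower and an upper
approximation with `A^△▲ ⊆ B` and `A ∩ S = B ∩ S`, ordered coordinatewise. -/
def DMPairs (R : U → U → Prop) : Set (Set U × Set U) :=
  {p | (∃ X, p.1 = lower R X) ∧ (∃ Y, p.2 = upper R Y) ∧
    upper R (upper (Function.swap R) p.1) ⊆ p.2 ∧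
    p.1 ∩ singletons R = p.2 ∩ singletons R}

/-- A bounded lattice with an operation `neg` is a De Morgan algebra. -/
structure IsDeMorganAlgebra {L : Type*} [Lattice L] [BoundedOrder L] (neg : L → L) : Prop where
  inf_sup_distrib : ∀ x y z : L, x ⊓ (y ⊔ z) = (x ⊓ y) ⊔ (x ⊓ z)
  neg_neg : ∀ x, neg (neg x) = x
  neg_sup : ∀ x y, neg (x ⊔ y) = neg x ⊓ neg y
  neg_inf : ∀ x y, neg (x ⊓ y) = neg x ⊔ neg y

/-- A Kleene algebra: a De Morgan algebra with `x ∧ ∼x ≤ y ∨ ∼y`. -/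
structure IsKleeneAlgebra {L : Type*} [Lattice L] [BoundedOrder L] (neg : L → L) : Prop
    extends IsDeMorganAlgebra neg where
  kleene : ∀ x y, x ⊓ neg x ≤ y ⊔ neg y

/-- A quasi-Nelson algebra: a Kleene algebra in which, for all `a` and `b`, the relative
pseudocomplement `a → b` of `a` with respect to `∼a ∨ b` exists, that is, the greatest `x` with
`a ∧ x ≤ ∼a ∨ b`. -/
structure IsQuasiNelsonAlgebra {L : Type*} [Lattice L] [BoundedOrder L]
    (neg : L → L) (imp : L → L → L) : Prop extends IsKleeneAlgebra neg where
  imp_isGreatest : ∀ a b, IsGreatest {x | a ⊓ x ≤ neg a ⊔ b} (imp a b)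

/-- A Nelson algebra: a quasi-Nelson algebra with `(a ∧ b) → c = a → (b → c)`. -/
structure IsNelsonAlgebra {L : Type*} [Lattice L] [BoundedOrder L]
    (neg : L → L) (imp : L → L → L) : Prop extends IsQuasiNelsonAlgebra neg imp where
  inf_imp : ∀ a b c, imp (a ⊓ b) c = imp a (imp b c)

end RoughSets

/-! Preorder `U` by `R(x) ⊆ R(y)`. A core point of `R(x)` lies in `R(y)` exactly when `R(x) ⊆ R(y)`,
so lower approximations are the down-sets and upper approximations the up-sets
(`exists_eq_lower_iff`). Cores of the inverse turn `A^△▲ ⊆ B` into `A ⊆ B` (`mem_DMPairs_iff`). The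
resulting pairs are closed under coordinatewise unions, intersections and swapped complements, hence
form a Kleene algebra; density of the rough sets identifies it with the completion. The condition on
`x` defining `a → b` involves only `a.1` and `b`, and survives unions, so a greatest `x` exists. The
Nelson identity then rests on `exists_extension`. -/

namespace RoughSets

/-! ### Recognizing a Dedekind-MacNeille completion -/

section Completion

/-- A set `T` in which `S` is join-dense and meet-dense and which has all suprema is a
Dedekind-MacNeille completion of `S`. -/
theorem exists_orderIso_dedekindCut {α : Type*} [PartialOrder α] {S T : Set α} (hST : S ⊆ T)
    (join_dense : ∀ p ∈ T, ∀ q ∈ T, (∀ r ∈ S, r ≤ p → r ≤ q) → p ≤ q)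
    (meet_dense : ∀ p ∈ T, ∀ q ∈ T, (∀ r ∈ S, p ≤ r → q ≤ r) → q ≤ p)
    (exists_sup : ∀ s ⊆ T, ∃ p ∈ T, ∀ q ∈ T, p ≤ q ↔ ∀ r ∈ s, r ≤ q) :
    ∃ e : DedekindCut S ≃o T, ∀ r : S, (e (DedekindCut.principal r) : α) = r := by
  -- Meet-density makes each principal trace on `S` a cut, join-density makes `p ↦ cut p` an order
  -- embedding, and suprema give surjectivity.
  have isExtent (p : T) : Order.IsExtent (· ≤ ·) {r : S | (r : α) ≤ p} := by
    rw [Order.isExtent_iff]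
    refine subset_antisymm (fun r hr => ?_) (subset_lowerPolar_upperPolar _ _)
    refine meet_dense _ p.2 _ (hST r.2) fun t ht hpt => ?_
    exact @hr ⟨t, ht⟩ fun u hu => le_trans (α := α) hu hpt
  let cut : T → DedekindCut S := fun p => Concept.ofObjects _ {r : S | (r : α) ≤ p}
  have cut_left (p : T) : (cut p).left = {r : S | (r : α) ≤ p} :=
    Concept.extent_ofObjects_of_isExtent (isExtent p)
  let f : T ↪o DedekindCut S := OrderEmbedding.ofMapLEIff cut fun p q => by
    rw [← Concept.extent_subset_extent_iff]
    change (cut p).left ⊆ (cut q).left ↔ _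
    rw [cut_left, cut_left]
    exact ⟨fun h => join_dense p p.2 q q.2 fun r hr hrp => h (a := ⟨r, hr⟩) hrp,
      fun h r hr => le_trans (α := α) hr h⟩
  have hf : Function.Surjective f := fun c => by
    obtain ⟨p, hp, hpq⟩ := exists_sup ((↑) '' c.left) (by
      rintro _ ⟨r, -, rfl⟩
      exact hST r.2)
    refine ⟨⟨p, hp⟩, DedekindCut.ext ?_⟩
    change (cut _).left = _
    rw [cut_left]
    ext r
    refine ⟨fun hr => ?_, fun hr => (hpq p hp).1 le_rfl r ⟨r, hr, rfl⟩⟩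
    rw [← DedekindCut.lowerBounds_right]
    intro t ht
    refine le_trans (α := α) hr ((hpq t (hST t.2)).2 ?_)
    rintro _ ⟨u, hu, rfl⟩
    exact Concept.rel_extent_intent (c := c) hu ht
  let e := RelIso.ofSurjective f hf
  refine ⟨e.symm, fun r => ?_⟩
  have : e ⟨r, hST r.2⟩ = DedekindCut.principal r := DedekindCut.ext (cut_left _)
  rw [← this]
  exact congrArg Subtype.val (e.symm_apply_apply _)

end Completion

/-! ### Pairs of a down-set and an up-set -/

section Pairs

variable {U : Type*} {R : U → U → Prop}

/-- Pairs `(A, B)` where `A` is closed downwards and `B` upwards in the preorder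
`R(x) ⊆ R(y)`, `A ⊆ B`, and each singleton in `B` is in `A`. -/
structure IsOrderPair (R : U → U → Prop) (p : Set U × Set U) : Prop where
  lower_mem : ∀ ⦃x y⦄, nbhd R x ⊆ nbhd R y → y ∈ p.1 → x ∈ p.1
  upper_mem : ∀ ⦃x y⦄, nbhd R x ⊆ nbhd R y → x ∈ p.2 → y ∈ p.2
  subset : p.1 ⊆ p.2
  singleton_mem : ∀ ⦃s⦄, nbhd R s = {s} → s ∈ p.2 → s ∈ p.1

theorem mem_singletons_iff (hR : ∀ x, R x x) {x : U} :
    x ∈ singletons R ↔ nbhd R x = {x} := by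
  refine ⟨fun ⟨z, hz⟩ => ?_, fun h => ⟨x, h⟩⟩
  have : x ∈ nbhd R x := hR x
  rw [hz] at this ⊢
  rw [Set.mem_singleton_iff.1 this]

theorem compl_upper (X : Set U) : (upper R X)ᶜ = lower R Xᶜ := by
  ext x
  simp only [upper, lower, Set.mem_compl_iff, Set.mem_ofPred_eq, Set.not_nonempty_iff_eq_empty]
  exact Set.disjoint_iff_inter_eq_empty.symm.trans Set.subset_compl_iff_disjoint_right.symm

theorem compl_lower (X : Set U) : (lower R X)ᶜ = upper R Xᶜ := by
  rw [← compl_compl (upper R Xᶜ), compl_upper, compl_compl]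

/-- If the core of `R(x)` is nonempty for all `x`, the lower approximations are the sets closed
downwards in the preorder `R(x) ⊆ R(y)`. -/
theorem exists_eq_lower_iff (hc : ∀ x, (core R x).Nonempty) {A : Set U} :
    (∃ X, A = lower R X) ↔ ∀ ⦃x y⦄, nbhd R x ⊆ nbhd R y → y ∈ A → x ∈ A := by
  constructor
  · rintro ⟨X, rfl⟩ x y hxy hy
    exact hxy.trans hy
  · refine fun h => ⟨⋃ a ∈ A, nbhd R a, subset_antisymm
      (fun x hx => Set.subset_biUnion_of_mem (u := nbhd R) hx) fun x hx => ?_⟩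
    -- A core point of `R(x)` lies in some `R(a)` with `a ∈ A`, which forces all of `R(x)` into
    -- `R(a)`.
    obtain ⟨w, hw, hwy⟩ := hc x
    obtain ⟨a, ha, hwa⟩ := Set.mem_iUnion₂.1 (hx hw)
    exact h (hwy a hwa) ha

theorem exists_eq_upper_iff (hc : ∀ x, (core R x).Nonempty) {B : Set U} :
    (∃ X, B = upper R X) ↔ ∀ ⦃x y⦄, nbhd R x ⊆ nbhd R y → x ∈ B → y ∈ B := by
  have : (∃ X, B = upper R X) ↔ ∃ X, Bᶜ = lower R X :=
    ⟨fun ⟨X, hX⟩ => ⟨Xᶜ, by rw [hX, compl_upper]⟩,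
      fun ⟨X, hX⟩ => ⟨Xᶜ, by rw [← compl_lower, ← hX, compl_compl]⟩⟩
  rw [this, exists_eq_lower_iff hc]
  exact ⟨fun h x y hxy => not_imp_not.1 (h hxy), fun h x y hxy => not_imp_not.2 (h hxy)⟩

theorem mem_upper_upper_swap {A : Set U} {y : U} :
    y ∈ upper R (upper (Function.swap R) A) ↔ ∃ z x, R y z ∧ R x z ∧ x ∈ A :=
  ⟨fun ⟨z, hyz, x, hxz, hx⟩ => ⟨z, x, hyz, hxz, hx⟩,
    fun ⟨z, x, hyz, hxz, hx⟩ => ⟨z, hyz, x, hxz, hx⟩⟩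

/-- If the core of each inverse neighbourhood is nonempty, two elements with a common
`R`-successor have a common lower bound in the preorder `R(x) ⊆ R(y)`. -/
theorem exists_nbhd_subset (hc : ∀ x, (core (Function.swap R) x).Nonempty) {x y z : U}
    (hx : R x z) (hy : R y z) : ∃ w, nbhd R w ⊆ nbhd R x ∧ nbhd R w ⊆ nbhd R y := by
  obtain ⟨w, -, hw⟩ := hc z
  exact ⟨w, fun v hv => hw v hv hx, fun v hv => hw v hv hy⟩

theorem mem_DMPairs_iff (hR : ∀ x, R x x) (hc : ∀ x, (core R x).Nonempty)
    (hc' : ∀ x, (core (Function.swap R) x).Nonempty) {p : Set U × Set U} :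
    p ∈ DMPairs R ↔ IsOrderPair R p := by
  change (_ ∧ _ ∧ _ ∧ _) ↔ _
  rw [exists_eq_lower_iff hc, exists_eq_upper_iff hc]
  constructor
  · rintro ⟨h1, h2, h3, h4⟩
    refine ⟨h1, h2, fun x hx => h3 (mem_upper_upper_swap.2 ⟨x, x, hR x, hR x, hx⟩),
      fun s hs hsB => ?_⟩
    have : s ∈ p.2 ∩ singletons R := ⟨hsB, s, hs⟩
    rw [← h4] at this
    exact this.1
  · rintro ⟨h1, h2, h3, h4⟩
    refine ⟨h1, h2, fun y hy => ?_, subset_antisymm (fun x hx => ⟨h3 hx.1, hx.2⟩)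
      fun x hx => ⟨h4 ((mem_singletons_iff hR).1 hx.2) hx.1, hx.2⟩⟩
    obtain ⟨z, x, hyz, hxz, hx⟩ := mem_upper_upper_swap.1 hy
    obtain ⟨w, hwx, hwy⟩ := exists_nbhd_subset hc' hxz hyz
    exact h2 hwy (h3 (h1 hwx hx))

namespace IsOrderPair

theorem of_rs (hR : ∀ x, R x x) {p : Set U × Set U} (hp : p ∈ RS R) : IsOrderPair R p := by
  obtain ⟨X, rfl⟩ := hp
  refine ⟨fun x y hxy hy => hxy.trans hy, fun x y hxy hx => hx.mono
    (Set.inter_subset_inter_left _ hxy), fun x hx => ⟨x, hR x, hx (hR x)⟩, fun s hs h => ?_⟩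
  obtain ⟨t, ht, htX⟩ := h
  change nbhd R s ⊆ X
  rw [hs] at ht ⊢
  rw [Set.mem_singleton_iff.1 ht] at htX
  exact Set.singleton_subset_iff.2 htX

theorem compl {p : Set U × Set U} (hp : IsOrderPair R p) : IsOrderPair R (p.2ᶜ, p.1ᶜ) :=
  ⟨fun _ _ hxy => not_imp_not.2 (hp.upper_mem hxy), fun _ _ hxy => not_imp_not.2 (hp.lower_mem hxy),
    Set.compl_subset_compl.2 hp.subset, fun _ hs => not_imp_not.2 (hp.singleton_mem hs)⟩

theorem inter {p q : Set U × Set U} (hp : IsOrderPair R p) (hq : IsOrderPair R q) :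
    IsOrderPair R (p.1 ∩ q.1, p.2 ∩ q.2) :=
  ⟨fun _ _ hxy => And.imp (hp.lower_mem hxy) (hq.lower_mem hxy),
    fun _ _ hxy => And.imp (hp.upper_mem hxy) (hq.upper_mem hxy),
    Set.inter_subset_inter hp.subset hq.subset,
    fun _ hs => And.imp (hp.singleton_mem hs) (hq.singleton_mem hs)⟩

theorem biUnion {s : Set (Set U × Set U)} (hs : ∀ p ∈ s, IsOrderPair R p) :
    IsOrderPair R (⋃ p ∈ s, p.1, ⋃ p ∈ s, p.2) := by
  constructor
  · intro x y hxy hy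
    obtain ⟨p, hp, hyp⟩ := Set.mem_iUnion₂.1 hy
    exact Set.mem_iUnion₂.2 ⟨p, hp, (hs p hp).lower_mem hxy hyp⟩
  · intro x y hxy hx
    obtain ⟨p, hp, hxp⟩ := Set.mem_iUnion₂.1 hx
    exact Set.mem_iUnion₂.2 ⟨p, hp, (hs p hp).upper_mem hxy hxp⟩
  · exact Set.iUnion₂_mono fun p hp => (hs p hp).subset
  · intro x hx hxB
    obtain ⟨p, hp, hxp⟩ := Set.mem_iUnion₂.1 hxB
    exact Set.mem_iUnion₂.2 ⟨p, hp, (hs p hp).singleton_mem hx hxp⟩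

theorem union {p q : Set U × Set U} (hp : IsOrderPair R p) (hq : IsOrderPair R q) :
    IsOrderPair R (p.1 ∪ q.1, p.2 ∪ q.2) :=
  ⟨fun _ _ hxy => Or.imp (hp.lower_mem hxy) (hq.lower_mem hxy),
    fun _ _ hxy => Or.imp (hp.upper_mem hxy) (hq.upper_mem hxy),
    Set.union_subset_union hp.subset hq.subset,
    fun _ hs => Or.imp (hp.singleton_mem hs) (hq.singleton_mem hs)⟩

theorem biUnion_le_iff {s : Set (Set U × Set U)} {q : Set U × Set U} :
    ((⋃ p ∈ s, p.1, ⋃ p ∈ s, p.2) : Set U × Set U) ≤ q ↔ ∀ p ∈ s, p ≤ q := by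
  simp only [Prod.le_def, Set.iUnion₂_subset_iff]
  exact ⟨fun h p hp => ⟨h.1 p hp, h.2 p hp⟩, fun h => ⟨fun p hp => (h p hp).1,
    fun p hp => (h p hp).2⟩⟩

/-- Two kinds of rough sets suffice: that of `R(x)` detects `x` in the first coordinate, and that of
`{z}`, with `z` in the core of `R(y)`, detects `y` in the second. -/
theorem le_of_forall_rs_le (hR : ∀ x, R x x) (hc : ∀ x, (core R x).Nonempty)
    (hc' : ∀ x, (core (Function.swap R) x).Nonempty) {p q : Set U × Set U}
    (hp : IsOrderPair R p) (h : ∀ r ∈ RS R, r ≤ p → r ≤ q) : p ≤ q := by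
  have h1 : p.1 ⊆ q.1 := fun x hx => by
    refine (h _ ⟨nbhd R x, rfl⟩ ⟨fun y hy => hp.lower_mem hy hx, fun y hy => ?_⟩).1
      (subset_refl (nbhd R x))
    obtain ⟨z, hyz, hxz⟩ := hy
    obtain ⟨w, hwx, hwy⟩ := exists_nbhd_subset hc' hxz hyz
    exact hp.upper_mem hwy (hp.subset (hp.lower_mem hwx hx))
  refine ⟨h1, fun y hy => ?_⟩
  obtain ⟨z, hz, hzy⟩ := hc y
  refine (h _ ⟨{z}, rfl⟩ ⟨fun u hu => ?_, fun u hu => ?_⟩).2 ⟨z, hz, rfl⟩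
  · have huz : u = z := hu (hR u)
    subst huz
    have hu' : nbhd R u = {u} := subset_antisymm hu (Set.singleton_subset_iff.2 (hR u))
    have hyu : y = u := hu (hzy u (hR u) (hR y))
    subst hyu
    exact hp.singleton_mem hu' hy
  · obtain ⟨t, hut, rfl⟩ := hu
    exact hp.upper_mem (hzy u hut) hy

/-- Dual to join-density: the swapped complement reverses the order and preserves rough sets. -/
theorem le_of_forall_le_rs (hR : ∀ x, R x x) (hc : ∀ x, (core R x).Nonempty)
    (hc' : ∀ x, (core (Function.swap R) x).Nonempty) {p q : Set U × Set U}
    (hp : IsOrderPair R p) (h : ∀ r ∈ RS R, p ≤ r → q ≤ r) : q ≤ p := by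
  have key := le_of_forall_rs_le hR hc hc' hp.compl (q := (q.2ᶜ, q.1ᶜ)) (by
    rintro _ ⟨X, rfl⟩ hX
    have := h _ ⟨Xᶜ, rfl⟩ (by
      rw [← compl_lower, ← compl_upper]
      exact ⟨Set.subset_compl_comm.1 hX.2, Set.subset_compl_comm.1 hX.1⟩)
    rw [← compl_lower, ← compl_upper] at this
    exact ⟨Set.subset_compl_comm.1 this.2, Set.subset_compl_comm.1 this.1⟩)
  exact ⟨Set.compl_subset_compl.1 key.2, Set.compl_subset_compl.1 key.1⟩

/-- If `p` intersected with `A` and `b.1` lies below `c`, then the part of `p` in `A` lies below a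
pair whose intersection with `b.1` lies below `c`. -/
theorem exists_extension {A : Set U} {p : Set U × Set U}
    (hA : ∀ ⦃x y⦄, nbhd R x ⊆ nbhd R y → y ∈ A → x ∈ A) (hR : ∀ x, R x x)
    (hp : IsOrderPair R p) {b c : Set U × Set U} (hb : IsOrderPair R b) (hc : IsOrderPair R c)
    (h1 : A ∩ b.1 ∩ p.1 ⊆ c.1) (h2 : A ∩ b.1 ∩ p.2 ⊆ c.2) :
    ∃ q, IsOrderPair R q ∧ A ∩ p.1 ⊆ q.1 ∧ A ∩ p.2 ⊆ q.2 ∧ b.1 ∩ q.1 ⊆ c.1 ∧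
      b.1 ∩ q.2 ⊆ c.2 := by
  -- Truncating `p` to `A` spoils the up-set coordinate, so `Y` is its up-closure. Singletons in `Y`
  -- must join the first coordinate; they are minimal in the preorder, so it stays a down-set.
  let Y : Set U := {y | ∃ x ∈ A ∩ p.2, nbhd R x ⊆ nbhd R y}
  have hY : b.1 ∩ Y ⊆ c.2 := by
    rintro y ⟨hy, x, hx, hxy⟩
    exact hc.upper_mem hxy (h2 ⟨⟨hx.1, hb.lower_mem hxy hy⟩, hx.2⟩)
  refine ⟨(A ∩ p.1 ∪ {s | nbhd R s = {s} ∧ s ∈ Y}, Y), ⟨?_, ?_, ?_, ?_⟩, Set.subset_union_left,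
    fun x hx => ⟨x, hx, subset_rfl⟩, ?_, hY⟩
  · rintro x y hxy (hy | hy)
    · exact Or.inl ⟨hA hxy hy.1, hp.lower_mem hxy hy.2⟩
    · rw [hy.1] at hxy
      have : x = y := hxy (hR x)
      exact Or.inr (this ▸ hy)
  · rintro x y hxy ⟨z, hz, hzx⟩
    exact ⟨z, hz, hzx.trans hxy⟩
  · rintro x (hx | hx)
    · exact ⟨x, ⟨hx.1, hp.subset hx.2⟩, subset_rfl⟩
    · exact hx.2
  · exact fun s hs hsY => Or.inr ⟨hs, hsY⟩
  · rintro x ⟨hxb, hx | hx⟩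
    · exact h1 ⟨⟨hx.1, hxb⟩, hx.2⟩
    · exact hc.singleton_mem hx.1 (hY ⟨hxb, hx.2⟩)

end IsOrderPair

end Pairs

/-! ### Nelson structure on a lattice isomorphic to the pairs -/

section Algebra

variable {U : Type*} {R : U → U → Prop} {L : Type*} [Lattice L]
  {T : Set (Set U × Set U)}

/-- The abstract meet is forced to be coordinatewise because the pairs are closed under
intersection. -/
theorem coe_map_inf (hT : ∀ p, p ∈ T ↔ IsOrderPair R p) (e : L ≃o T) (a b : L) :
    (e (a ⊓ b) : Set U × Set U) = ((e a).1.1 ∩ (e b).1.1, (e a).1.2 ∩ (e b).1.2) := by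
  let q : T := ⟨_, (hT _).2 (((hT _).1 (e a).2).inter ((hT _).1 (e b).2))⟩
  have h1 : e.symm q ≤ a ⊓ b := le_inf
    (e.symm_apply_le.2 ⟨Set.inter_subset_left, Set.inter_subset_left⟩)
    (e.symm_apply_le.2 ⟨Set.inter_subset_right, Set.inter_subset_right⟩)
  have ha : e (a ⊓ b) ≤ e a := e.monotone inf_le_left
  have hb : e (a ⊓ b) ≤ e b := e.monotone inf_le_right
  exact le_antisymm (α := Set U × Set U)
    ⟨Set.subset_inter ha.1 hb.1, Set.subset_inter ha.2 hb.2⟩ (e.symm_apply_le.1 h1)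

theorem coe_map_sup (hT : ∀ p, p ∈ T ↔ IsOrderPair R p) (e : L ≃o T) (a b : L) :
    (e (a ⊔ b) : Set U × Set U) = ((e a).1.1 ∪ (e b).1.1, (e a).1.2 ∪ (e b).1.2) := by
  let q : T := ⟨_, (hT _).2 (((hT _).1 (e a).2).union ((hT _).1 (e b).2))⟩
  have h1 : a ⊔ b ≤ e.symm q := sup_le
    (e.le_symm_apply.2 ⟨Set.subset_union_left, Set.subset_union_left⟩)
    (e.le_symm_apply.2 ⟨Set.subset_union_right, Set.subset_union_right⟩)
  have ha : e a ≤ e (a ⊔ b) := e.monotone le_sup_left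
  have hb : e b ≤ e (a ⊔ b) := e.monotone le_sup_right
  exact le_antisymm (α := Set U × Set U) (e.le_symm_apply.1 h1)
    ⟨Set.union_subset ha.1 hb.1, Set.union_subset ha.2 hb.2⟩

theorem exists_isNelsonAlgebra [BoundedOrder L] (hR : ∀ x, R x x)
    (hT : ∀ p, p ∈ T ↔ IsOrderPair R p) (e : L ≃o T) :
    ∃ (neg : L → L) (imp : L → L → L),
      (∀ c, (e (neg c) : Set U × Set U) = ((e c).1.2ᶜ, (e c).1.1ᶜ)) ∧
        IsNelsonAlgebra neg imp := by
  have pair (a : L) : IsOrderPair R (e a).1 := (hT _).1 (e a).2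
  let neg : L → L := fun a => e.symm ⟨_, (hT _).2 (pair a).compl⟩
  have coe_neg (a : L) : (e (neg a) : Set U × Set U) = ((e a).1.2ᶜ, (e a).1.1ᶜ) :=
    congrArg Subtype.val (e.apply_symm_apply _)
  have coe_le {a b : L} : a ≤ b ↔ (e a).1.1 ⊆ (e b).1.1 ∧ (e a).1.2 ⊆ (e b).1.2 :=
    e.le_iff_le.symm
  have coe_ext {a b : L} (h : (e a).1 = (e b).1) : a = b := e.injective (Subtype.ext h)
  -- Since `a.1 ⊆ a.2`, removing `neg a` from the right leaves `a.1` as the only restriction in both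
  -- coordinates.
  have le_neg_sup {a x b : L} : a ⊓ x ≤ neg a ⊔ b ↔
      (e a).1.1 ∩ (e x).1.1 ⊆ (e b).1.1 ∧ (e a).1.1 ∩ (e x).1.2 ⊆ (e b).1.2 := by
    rw [coe_le, coe_map_inf hT, coe_map_sup hT, coe_neg]
    refine and_congr ⟨fun h u hu => (h hu).resolve_left (not_not.2 ((pair a).subset hu.1)),
      fun h u hu => Or.inr (h hu)⟩ ⟨fun h u hu =>
        (h ⟨(pair a).subset hu.1, hu.2⟩).resolve_left (not_not.2 hu.1), fun h u hu => ?_⟩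
    by_cases hua : u ∈ (e a).1.1
    · exact Or.inr (h ⟨hua, hu.2⟩)
    · exact Or.inl hua
  have exists_imp (a b : L) : ∃ g, IsGreatest {x | a ⊓ x ≤ neg a ⊔ b} g := by
    let s : Set (Set U × Set U) := {q | IsOrderPair R q ∧ (e a).1.1 ∩ q.1 ⊆ (e b).1.1 ∧
      (e a).1.1 ∩ q.2 ⊆ (e b).1.2}
    let g : T := ⟨_, (hT _).2 (IsOrderPair.biUnion (s := s) fun q hq => hq.1)⟩
    refine ⟨e.symm g, ?_, fun x hx => ?_⟩
    · change a ⊓ e.symm g ≤ _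
      rw [le_neg_sup, e.apply_symm_apply]
      constructor
      · rintro u ⟨hua, hu⟩
        obtain ⟨q, hq, huq⟩ := Set.mem_iUnion₂.1 hu
        exact hq.2.1 ⟨hua, huq⟩
      · rintro u ⟨hua, hu⟩
        obtain ⟨q, hq, huq⟩ := Set.mem_iUnion₂.1 hu
        exact hq.2.2 ⟨hua, huq⟩
    · rw [e.le_symm_apply]
      exact IsOrderPair.biUnion_le_iff.1 le_rfl _ ⟨pair x, le_neg_sup.1 hx⟩
  choose imp himp using exists_imp
  have le_imp {a b x : L} : x ≤ imp a b ↔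
      (e a).1.1 ∩ (e x).1.1 ⊆ (e b).1.1 ∧ (e a).1.1 ∩ (e x).1.2 ⊆ (e b).1.2 := by
    rw [← le_neg_sup]
    exact ⟨fun h => (inf_le_inf_left a h).trans (himp a b).1, fun h => (himp a b).2 h⟩
  refine ⟨neg, imp, coe_neg, ⟨⟨⟨?_, ?_, ?_, ?_⟩, ?_⟩, ?_⟩, ?_⟩
  · intro x y z
    refine coe_ext ?_
    simp only [coe_map_inf hT, coe_map_sup hT, Set.inter_union_distrib_left]
  · intro x
    refine coe_ext ?_
    simp only [coe_neg, compl_compl]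
  · intro x y
    refine coe_ext ?_
    simp only [coe_neg, coe_map_inf hT, coe_map_sup hT, Set.compl_union]
  · intro x y
    refine coe_ext ?_
    simp only [coe_neg, coe_map_inf hT, coe_map_sup hT, Set.compl_inter]
  · intro x y
    simp only [coe_le, coe_neg, coe_map_inf hT, coe_map_sup hT]
    refine ⟨fun u hu => absurd ((pair x).subset hu.1) hu.2, fun u _ => ?_⟩
    by_cases hu : u ∈ (e y).1.1
    · exact Or.inl ((pair y).subset hu)
    · exact Or.inr hu
  · exact himp
  · intro a b c
    refine eq_of_forall_le_iff fun x => ?_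
    rw [le_imp, le_imp, coe_map_inf hT]
    obtain ⟨hbc1, hbc2⟩ := le_imp.1 (le_refl (imp b c))
    constructor
    · rintro ⟨h1, h2⟩
      -- The part of `x` in `a.1` need not be a pair, so it is enlarged to a pair `q` below `b → c`.
      obtain ⟨q, hq, hq1, hq2, hq3, hq4⟩ :=
        IsOrderPair.exists_extension (pair a).lower_mem hR (pair x) (pair b) (pair c) h1 h2
      have hle : e.symm ⟨q, (hT _).2 hq⟩ ≤ imp b c := by
        rw [le_imp, e.apply_symm_apply]
        exact ⟨hq3, hq4⟩
      have hle := e.symm_apply_le.1 hle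
      exact ⟨hq1.trans hle.1, hq2.trans hle.2⟩
    · rintro ⟨h1, h2⟩
      exact ⟨fun u hu => hbc1 ⟨hu.1.2, h1 ⟨hu.1.1, hu.2⟩⟩,
        fun u hu => hbc2 ⟨hu.1.2, h2 ⟨hu.1.1, hu.2⟩⟩⟩

end Algebra

/-- All pairs in `Fin 3` except `(2, 1)`: the cores are nonempty, but `2, 0, 1` violates
transitivity. -/
theorem exists_not_transitive : ∃ (U : Type) (R : U → U → Prop),
    (∀ x, R x x) ∧ (∀ x, (core R x).Nonempty) ∧
      (∀ x, (core (Function.swap R) x).Nonempty) ∧ ¬ ∀ x y z, R x y → R y z → R x z := by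
  refine ⟨Fin 3, fun x y => ¬ (x = 2 ∧ y = 1), by decide, ?_, ?_, by decide⟩ <;>
  · simp only [Set.Nonempty, core, nbhd, Set.mem_ofPred_eq, Set.ofPred_subset_ofPred, Function.swap]
    decide

end RoughSets

theorem mainTheorem6 :
    (∀ (U : Type*) (R : U → U → Prop),
      (∀ x, R x x) →
      (∀ x, (RoughSets.core R x).Nonempty) →
      (∀ x, (RoughSets.core (Function.swap R) x).Nonempty) →
      ∃ e : RoughSets.DM R ≃o RoughSets.DMPairs R,
        (∀ r : RoughSets.RS R,
          (e (DedekindCut.principal r) : Set U × Set U) = (r : Set U × Set U)) ∧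
        ∃ (neg : RoughSets.DM R → RoughSets.DM R)
          (imp : RoughSets.DM R → RoughSets.DM R → RoughSets.DM R),
          (∀ c, (e (neg c) : Set U × Set U) =
            ((e c : Set U × Set U).2ᶜ, (e c : Set U × Set U).1ᶜ)) ∧
          RoughSets.IsNelsonAlgebra neg imp) ∧
    (∃ (U : Type) (R : U → U → Prop),
      (∀ x, R x x) ∧
      (∀ x, (RoughSets.core R x).Nonempty) ∧
      (∀ x, (RoughSets.core (Function.swap R) x).Nonempty) ∧
      ¬ ∀ x y z, R x y → R y z → R x z) := by
  refine ⟨fun U R hR hc hc' => ?_, RoughSets.exists_not_transitive⟩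
  have hT (p : Set U × Set U) : p ∈ RoughSets.DMPairs R ↔ RoughSets.IsOrderPair R p :=
    RoughSets.mem_DMPairs_iff hR hc hc'
  obtain ⟨e, he⟩ := RoughSets.exists_orderIso_dedekindCut
    (S := RoughSets.RS R) (T := RoughSets.DMPairs R)
    (fun p hp => (hT p).2 (.of_rs hR hp))
    (fun p hp _ _ => RoughSets.IsOrderPair.le_of_forall_rs_le hR hc hc' ((hT p).1 hp))
    (fun p hp _ _ => RoughSets.IsOrderPair.le_of_forall_le_rs hR hc hc' ((hT p).1 hp))
    (fun s hs => ⟨_, (hT _).2 (.biUnion fun p hp => (hT p).1 (hs hp)),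
      fun q _ => RoughSets.IsOrderPair.biUnion_le_iff⟩)
  exact ⟨e, he, RoughSets.exists_isNelsonAlgebra hR hT e⟩
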